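/- Let $R$ be a commutative ring and $d\ge 0$ an integer. A $\mathbb Z/d\mathbb Z$-graded differential module is an $R$-module $D=\bigoplus_{j\in\mathbb Z/d\mathbb Z}D_j$ with an $R$-linear endomorphism $d^D$ such that $(d^D)^2=0$ and $d^D(D_j)\subseteq D_{j-1}$; put $H_j(D)=\ker(d^D|_{D_j})/d^D(D_{j+1})$. A morphism is an $R$-linear map of degree $0$ commuting with the differentials; it is a quasi-isomorphism if it induces isomorphisms on all $H_j$. Morphisms $f,g:D\to D'$ are homotopic if $f-g=d^{D'}h+hd^D$ for an $R$-linear map $h$ with $h(D_j)\subseteq D'_{j+1}$. A flag is such a module $F$ with filtrations $0=F^{-1}_j\subseteq F^0_j\subseteq F^1_j\subseteq\cdots$, $\bigcup_iF^i_j=F_j$, such that $d^F(F^i_j)\subseteq F^{i-1}_{j-1}$. It is projective if all $F^i_k/F^{i-1}_k$ are projective. With $F_{i,j}=F^i_{i+j}/F^{i-1}_{i+j}$, its anchor is the direct sum over $j\in\mathbb Z/d\mathbb Z$ of the complexes $\cdots\to F_{2,j}\to F_{1,j}\to F_{0,j}$ with the maps induced by $d^F$. A morphism $f:F\to F'$ of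 differential modules between flags is flag-preserving if $f(F^i_j)\subseteq F'^i_j$ for all $i,j$, and a homotopy $h$ is flag-preserving if $h(F^i_j)\subseteq F'^{i+1}_{j+1}$ for all $i,j$. An anchored resolution of $D$ is a projective flag $F$ with a quasi-isomorphism $F\to D$ (the augmentation) such that, for every $j$, the complex $F_{\bullet,j}$ is a projective resolution of $H_j(D)$. **Theorem.** 1. Every $\mathbb Z/d\mathbb Z$-graded differential module has an anchored resolution. If $\phi:D\to D'$ is a morphism of $\mathbb Z/d\mathbb Z$-graded differential modules and $\varepsilon:F\to D$, $\varepsilon':F'\to D'$ are any anchored resolutions, then there is a flag-preserving morphism $\widetilde\phi:F\to F'$ such that $\varepsilon'\widetilde\phi$ and $\phi\varepsilon$ are homotopic. 2. Any two anchored resolutions $F,F'$ of a fixed differential module $D$ are homotopy equivalent in a flag-preserving way: there are flag-preserving morphisms $f:F\to F'$ and $g:F'\to F$ such that $gf$ and $fg$ are homotopic to the identities by flag-preserving homotopies. -/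

import Mathlib

universe u v

/-- A `ℤ/d`-graded differential `R`-module: an `R`-module with a direct sum decomposition
`D = ⨁ j, D_j` indexed by `ℤ/d` and a square-zero endomorphism of degree `-1`.
Since `ZMod 0 = ℤ`, the case `d = 0` is that of (unbounded) chain complexes. -/
structure GrDiffMod (R : Type u) [CommRing R] (d : ℕ) where
  carrier : Type v
  [addCommGroup : AddCommGroup carrier]
  [module : Module R carrier]
  /-- the graded piece `D_j` -/
  grade : ZMod d → Submodule R carrier
  isInternal : DirectSum.IsInternal grade
  /-- the differential -/
  diff : carrier →ₗ[R] carrier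
  diff_diff : ∀ x, diff (diff x) = 0
  diff_mem : ∀ j, ∀ x ∈ grade j, diff x ∈ grade (j - 1)

attribute [instance] GrDiffMod.addCommGroup GrDiffMod.module

namespace GrDiffMod

variable {R : Type u} [CommRing R] {d : ℕ}

/-- A morphism of `ℤ/d`-graded differential modules: an `R`-linear map of degree `0` that commutes
with the differentials. -/
structure Hom (D D' : GrDiffMod.{u, v} R d) where
  toLin : D.carrier →ₗ[R] D'.carrier
  map_mem : ∀ j, ∀ x ∈ D.grade j, toLin x ∈ D'.grade j
  comm : ∀ x, D'.diff (toLin x) = toLin (D.diff x)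

/-- The identity morphism. -/
def Hom.id (D : GrDiffMod.{u, v} R d) : Hom D D where
  toLin := LinearMap.id
  map_mem := fun _ _ hx => hx
  comm := fun _ => rfl

/-- The composite `g ∘ f` of morphisms. -/
def Hom.comp {D D' D'' : GrDiffMod.{u, v} R d} (g : Hom D' D'') (f : Hom D D') : Hom D D'' where
  toLin := g.toLin ∘ₗ f.toLin
  map_mem := fun j x hx => g.map_mem j _ (f.map_mem j x hx)
  comm := fun x => by simp [g.comm, f.comm]

/-- `f` and `g` are homotopic: `f - g = d h + h d` for some `R`-linear map `h` of degree `1`. -/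
def Homotopic {D D' : GrDiffMod.{u, v} R d} (f g : Hom D D') : Prop :=
  ∃ h : D.carrier →ₗ[R] D'.carrier,
    (∀ j, ∀ x ∈ D.grade j, h x ∈ D'.grade (j + 1)) ∧
    ∀ x, f.toLin x - g.toLin x = D'.diff (h x) + h (D.diff x)

/-- The cycles `Z_j(D) = ker (d : D_j → D_{j-1})`. -/
def cycles (D : GrDiffMod.{u, v} R d) (j : ZMod d) : Submodule R D.carrier :=
  D.grade j ⊓ LinearMap.ker D.diff

/-- The boundaries `B_j(D) = im (d : D_{j+1} → D_j)`. -/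
def boundaries (D : GrDiffMod.{u, v} R d) (j : ZMod d) : Submodule R D.carrier :=
  (D.grade (j + 1)).map D.diff

/-- The homology `H_j(D) = Z_j(D) / B_j(D)`. -/
abbrev homology (D : GrDiffMod.{u, v} R d) (j : ZMod d) : Type v :=
  D.cycles j ⧸ (D.boundaries j).submoduleOf (D.cycles j)

theorem Hom.map_cycles {D D' : GrDiffMod.{u, v} R d} (f : Hom D D') (j : ZMod d) :
    ∀ x ∈ D.cycles j, f.toLin x ∈ D'.cycles j := by
  rintro x ⟨hx, hd⟩
  refine ⟨f.map_mem j x hx, ?_⟩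
  have hd' : D.diff x = 0 := hd
  change D'.diff (f.toLin x) = 0
  rw [f.comm, hd', map_zero]

theorem Hom.map_boundaries {D D' : GrDiffMod.{u, v} R d} (f : Hom D D') (j : ZMod d) :
    ∀ x ∈ D.boundaries j, f.toLin x ∈ D'.boundaries j := by
  rintro _ ⟨y, hy, rfl⟩
  exact ⟨f.toLin y, f.map_mem _ y hy, f.comm y⟩

/-- The map `H_j(D) → H_j(D')` induced by a morphism. -/
def Hom.homologyMap {D D' : GrDiffMod.{u, v} R d} (f : Hom D D') (j : ZMod d) :
    D.homology j →ₗ[R] D'.homology j :=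
  Submodule.mapQ _ _ (f.toLin.restrict (f.map_cycles j)) (by
    intro x hx
    exact f.map_boundaries j _ hx)

/-- A quasi-isomorphism is a morphism that induces an isomorphism on homology. -/
def Hom.IsQuasiIso {D D' : GrDiffMod.{u, v} R d} (f : Hom D D') : Prop :=
  ∀ j, Function.Bijective (f.homologyMap j)

end GrDiffMod

/-- A `ℤ/d`-graded flag: a `ℤ/d`-graded differential module together with an exhaustive filtration
`0 = D^{-1}_j ⊆ D^0_j ⊆ D^1_j ⊆ ⋯` of each `D_j` such that `d (D^i_j) ⊆ D^{i-1}_{j-1}`. -/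
structure GrFlag (R : Type u) [CommRing R] (d : ℕ) extends GrDiffMod.{u, v} R d where
  /-- the filtration piece `D^i_j` -/
  fil : ℕ → ZMod d → Submodule R carrier
  fil_le_grade : ∀ i j, fil i j ≤ grade j
  fil_le_succ : ∀ i j, fil i j ≤ fil (i + 1) j
  exhaustive : ∀ j, ∀ x ∈ grade j, ∃ i, x ∈ fil i j
  diff_fil_zero : ∀ j, ∀ x ∈ fil 0 j, diff x = 0
  diff_fil_succ : ∀ i j, ∀ x ∈ fil (i + 1) j, diff x ∈ fil i (j - 1)

namespace GrFlag

variable {R : Type u} [CommRing R] {d : ℕ}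

/-- The filtration piece `D^{i-1}_j`, which is `0` for `i = 0`. -/
def filPred (F : GrFlag.{u, v} R d) : ℕ → ZMod d → Submodule R F.carrier
  | 0, _ => ⊥
  | i + 1, j => F.fil i j

/-- The associated graded piece `D^i_k / D^{i-1}_k`. -/
abbrev gr (F : GrFlag.{u, v} R d) (i : ℕ) (k : ZMod d) : Type v :=
  F.fil i k ⧸ (F.filPred i k).submoduleOf (F.fil i k)

theorem diff_fil_succ' (F : GrFlag.{u, v} R d) (i : ℕ) (k l : ZMod d) (h : k = l + 1) :
    ∀ x ∈ F.fil (i + 1) k, F.diff x ∈ F.fil i l := by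
  intro x hx
  subst h
  simpa using F.diff_fil_succ i _ x hx

theorem diff_filPred_succ (F : GrFlag.{u, v} R d) (i : ℕ) (k l : ZMod d) (h : k = l + 1) :
    ∀ x ∈ F.filPred (i + 1) k, F.diff x ∈ F.filPred i l := by
  intro x hx
  cases i with
  | zero => exact (Submodule.mem_bot R).2 (F.diff_fil_zero k x hx)
  | succ i => exact F.diff_fil_succ' i k l h x hx

/-- The map `D^{i+1}_k / D^i_k → D^i_{k-1} / D^{i-1}_{k-1}` induced by the differential. -/
def grDiff (F : GrFlag.{u, v} R d) (i : ℕ) (k l : ZMod d) (h : k = l + 1) :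
    F.gr (i + 1) k →ₗ[R] F.gr i l :=
  Submodule.mapQ _ _ (F.diff.restrict (F.diff_fil_succ' i k l h)) (by
    intro x hx
    exact F.diff_filPred_succ i k l h _ hx)

/-- The term `D_{i,j} = D^i_{i+j} / D^{i-1}_{i+j}` of the anchor; it has `ℤ/d`-degree `i + j`. -/
abbrev anchor (F : GrFlag.{u, v} R d) (j : ZMod d) (i : ℕ) : Type v :=
  F.gr i ((i : ZMod d) + j)

/-- The differential `δ₀ : D_{i+1,j} → D_{i,j}` of the anchor complex
`⋯ → D_{2,j} → D_{1,j} → D_{0,j}`. -/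
def anchorDiff (F : GrFlag.{u, v} R d) (j : ZMod d) (i : ℕ) :
    F.anchor j (i + 1) →ₗ[R] F.anchor j i :=
  F.grDiff i _ _ (by push_cast; ring)

/-- A flag is projective if all its associated graded pieces are projective `R`-modules. -/
def IsProjective (F : GrFlag.{u, v} R d) : Prop :=
  ∀ i k, Module.Projective R (F.gr i k)

/-- The complex `⋯ → D_{2,j} → D_{1,j} → D_{0,j}` (a summand of the anchor) is a projective
resolution of the module `M`: its terms are projective, and for some augmentation
`D_{0,j} → M` the sequence `⋯ → D_{2,j} → D_{1,j} → D_{0,j} → M → 0` is exact. -/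
def AnchorResolves (F : GrFlag.{u, v} R d) (j : ZMod d) (M : Type v) [AddCommGroup M]
    [Module R M] : Prop :=
  (∀ i, Module.Projective R (F.anchor j i)) ∧
  (∀ i, Function.Exact (F.anchorDiff j (i + 1)) (F.anchorDiff j i)) ∧
  ∃ π : F.anchor j 0 →ₗ[R] M, Function.Exact (F.anchorDiff j 0) π ∧ Function.Surjective π

/-- A morphism of the underlying differential modules is flag-preserving if it maps `D^i_j` into
`D'^i_j`. -/
def FlagPreserving {F F' : GrFlag.{u, v} R d} (f : GrDiffMod.Hom F.toGrDiffMod F'.toGrDiffMod) :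
    Prop :=
  ∀ i j, ∀ x ∈ F.fil i j, f.toLin x ∈ F'.fil i j

/-- `f` and `g` are homotopic by a flag-preserving homotopy: `f - g = d h + h d` for some
`R`-linear map `h` that maps `D^i_j` into `D'^{i+1}_{j+1}`. -/
def FlagHomotopic {F F' : GrFlag.{u, v} R d} (f g : GrDiffMod.Hom F.toGrDiffMod F'.toGrDiffMod) :
    Prop :=
  ∃ h : F.carrier →ₗ[R] F'.carrier,
    (∀ i j, ∀ x ∈ F.fil i j, h x ∈ F'.fil (i + 1) (j + 1)) ∧
    ∀ x, f.toLin x - g.toLin x = F'.diff (h x) + h (F.diff x)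

/-- Two flags are homotopy equivalent in a flag-preserving way: there are flag-preserving morphisms
in both directions whose composites are homotopic to the identities by flag-preserving
homotopies. -/
def FlagHomotopyEquivalent (F F' : GrFlag.{u, v} R d) : Prop :=
  ∃ (f : GrDiffMod.Hom F.toGrDiffMod F'.toGrDiffMod)
    (g : GrDiffMod.Hom F'.toGrDiffMod F.toGrDiffMod),
    FlagPreserving f ∧ FlagPreserving g ∧
    FlagHomotopic (g.comp f) (GrDiffMod.Hom.id F.toGrDiffMod) ∧
    FlagHomotopic (f.comp g) (GrDiffMod.Hom.id F'.toGrDiffMod)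

end GrFlag

/-- An anchored resolution of a `ℤ/d`-graded differential module `D`: a projective flag `F` with a
quasi-isomorphism `F → D` of differential modules (not required to respect any filtration), whose
anchor is a projective resolution of the homology `H(D) = ⨁ j, H_j(D)`. -/
structure AnchoredResolution {R : Type u} [CommRing R] {d : ℕ} (D : GrDiffMod.{u, v} R d) where
  flag : GrFlag.{u, v} R d
  aug : GrDiffMod.Hom flag.toGrDiffMod D
  isQuasiIso : aug.IsQuasiIso
  isProjective : flag.IsProjective
  anchorResolves : ∀ j, flag.AnchorResolves j (D.homology j)

/-! Everything goes through one condition, `GrFlag.FilteredAcyclic`: the mapping cone of the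
augmentation `ε : F → D` is acyclic with control of the filtration, so a cone cycle `(a, b)` with
`a` in `F^{n-1}` bounds some `(y, w)` with `y` in `F^n`. Anchored resolutions satisfy it
(`filteredAcyclic_of_isQuasiIso`), and a projective flag that satisfies it is an anchored resolution
(`AnchoredResolution.ofFilteredAcyclic`).

Lifts and homotopies both come from `IsProjective.exists_contraction`: a map from a projective flag
into a suitably acyclic target is null-homotopic, by induction on the filtration. With the cone of
`ε'` as target, a contraction of `(0, φε)` has a lift and its homotopy as its two components; a
contraction of `(f - g, s)`, with `s` a homotopy from `ε'f` to `ε'g`, has a flag-preserving homotopy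
from `f` to `g` as first component. Homotopy equivalence follows formally.

For existence, a free flag is built in one stroke: for every cone cycle `(a, b)` with `a` of level
below `n` there is a generator of level `n` with boundary `a` and value `b`. The generators form an
inductive type of trees, and filtered acyclicity then holds by construction. -/

/-! ### Extension and gluing of linear maps -/

/-- Extension of a lift along a submodule with projective quotient: if `δ ∘ f = t` on `N`, with
`f` taking values in `B`, and `t` takes values in `δ(B)`, then `f` extends to such a lift on `M`. -/
theorem LinearMap.exists_lift_extending {R M C C' : Type*} [CommRing R] [AddCommGroup M]
    [Module R M] [AddCommGroup C] [Module R C] [AddCommGroup C'] [Module R C']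
    (N : Submodule R M) [Module.Projective R (M ⧸ N)] (B : Submodule R C) (δ : C →ₗ[R] C')
    (t : M →ₗ[R] C') (f : N →ₗ[R] C) (hB : ∀ x, f x ∈ B) (ht : ∀ x, t x ∈ B.map δ)
    (hf : ∀ x : N, δ (f x) = t x) :
    ∃ f' : M →ₗ[R] C, (∀ x : N, f' x = f x) ∧ (∀ x, f' x ∈ B) ∧ ∀ x, δ (f' x) = t x := by
  -- `s` splits `M → M ⧸ N`. On the complement `s (M ⧸ N)` the map `t` is lifted through the
  -- surjection `B → δ(B)`; on `N` the given `f` is kept.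
  obtain ⟨s, hs⟩ := Module.projective_lifting_property N.mkQ LinearMap.id N.mkQ_surjective
  have hs' : ∀ x, N.mkQ (s x) = x := fun x => LinearMap.congr_fun hs x
  obtain ⟨q, hq⟩ := Module.projective_lifting_property
    (δ.restrict (p := B) (q := B.map δ) fun x hx => Submodule.mem_map_of_mem hx)
    ((t ∘ₗ s).codRestrict (B.map δ) fun x => ht _)
    (by rintro ⟨_, b, hb, rfl⟩; exact ⟨⟨b, hb⟩, rfl⟩)
  have hq' : ∀ x, δ (q x) = t (s x) := fun x => congrArg Subtype.val (LinearMap.congr_fun hq x)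
  have hr : ∀ x, (LinearMap.id - s ∘ₗ N.mkQ : M →ₗ[R] M) x ∈ N := fun x => by
    have h : N.mkQ (x - s (N.mkQ x)) = 0 := by rw [map_sub, hs', sub_self]
    exact (Submodule.Quotient.mk_eq_zero N).1 h
  refine ⟨f ∘ₗ (LinearMap.id - s ∘ₗ N.mkQ).codRestrict N hr + B.subtype ∘ₗ q ∘ₗ N.mkQ,
    fun x => ?_, fun x => B.add_mem (hB _) (q _).2, fun x => ?_⟩
  · have hx : N.mkQ (x : M) = 0 := (Submodule.Quotient.mk_eq_zero N).2 x.2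
    have hx' : (LinearMap.id - s ∘ₗ N.mkQ).codRestrict N hr x = x :=
      Subtype.ext (by simp [LinearMap.codRestrict_apply, hx, -Submodule.mkQ_apply])
    simp only [LinearMap.add_apply, LinearMap.comp_apply, hx', hx, map_zero, add_zero]
  · simp only [LinearMap.add_apply, LinearMap.comp_apply, map_add, hf, Submodule.subtype_apply,
      hq']
    rw [← map_add]
    simp [LinearMap.codRestrict_apply]

/-- Linear maps on an increasing exhaustive sequence of submodules glue. -/
theorem Submodule.exists_glue_of_monotone {R M C : Type*} [CommRing R] [AddCommGroup M]
    [Module R M] [AddCommGroup C] [Module R C] (G : Submodule R M) (N : ℕ → Submodule R M)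
    (hN : Monotone N) (hNG : ∀ x ∈ G, ∃ n, x ∈ N n) (f : ∀ n, N n →ₗ[R] C)
    (hf : ∀ n (x : N n), f (n + 1) ⟨x, hN n.le_succ x.2⟩ = f n x) :
    ∃ F : G →ₗ[R] C, ∀ n (x : G) (hx : (x : M) ∈ N n), F x = f n ⟨x, hx⟩ := by
  have key : ∀ m n (_ : n ≤ m) (x : M) (hm : x ∈ N m) (hn : x ∈ N n),
      f m ⟨x, hm⟩ = f n ⟨x, hn⟩ := by
    intro m n hmn x
    induction m, hmn using Nat.le_induction with
    | base => intro _ _; rfl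
    | succ m hmn ih => intro hm hn; rw [← ih (hN hmn hn) hn]; exact hf m ⟨x, hN hmn hn⟩
  have key' : ∀ m n (x : M) (hm : x ∈ N m) (hn : x ∈ N n), f m ⟨x, hm⟩ = f n ⟨x, hn⟩ := by
    intro m n x hm hn
    rcases le_total n m with h | h
    · exact key m n h x hm hn
    · exact (key n m h x hn hm).symm
  choose ν hν using hNG
  refine ⟨⟨⟨fun x => f (ν x x.2) ⟨x, hν x x.2⟩, fun x y => ?_⟩, fun r x => ?_⟩, fun n x hx => key' _ _ _ _ _⟩
  · have hx : (x : M) ∈ N (ν x x.2 ⊔ ν y y.2) := hN le_sup_left (hν x x.2)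
    have hy : (y : M) ∈ N (ν x x.2 ⊔ ν y y.2) := hN le_sup_right (hν y y.2)
    rw [key' _ _ _ _ hx, key' _ _ _ _ hy, key' _ _ (x + y : G).1 _ (add_mem hx hy), ← map_add]
    rfl
  · have hx : (x : M) ∈ N (ν x x.2) := hν x x.2
    exact (key' _ _ (r • x : G).1 _ ((N _).smul_mem r hx)).trans ((f _).map_smul r ⟨x, hx⟩)

/-- Linear maps on the summands of an internal direct sum glue. -/
theorem DirectSum.IsInternal.exists_glue {R M C ι : Type*} [DecidableEq ι] [CommRing R]
    [AddCommGroup M] [Module R M] [AddCommGroup C] [Module R C] {G : ι → Submodule R M}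
    (hG : DirectSum.IsInternal G) (f : ∀ i, G i →ₗ[R] C) :
    ∃ F : M →ₗ[R] C, ∀ i (x : G i), F x = f i x := by
  let e := LinearEquiv.ofBijective (DirectSum.coeLinearMap G) hG
  refine ⟨DirectSum.toModule R ι C f ∘ₗ e.symm.toLinearMap, fun i x => ?_⟩
  have : e.symm (x : M) = DirectSum.lof R ι (fun i => G i) i x := by
    rw [LinearEquiv.symm_apply_eq]
    exact (DirectSum.coeLinearMap_lof G i x).symm
  simp [this]

/-- Linear maps that agree on the summands of an internal direct sum are equal. -/
theorem DirectSum.IsInternal.linearMap_ext {R M C ι : Type*} [DecidableEq ι] [CommRing R]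
    [AddCommGroup M] [Module R M] [AddCommGroup C] [Module R C] {G : ι → Submodule R M}
    (hG : DirectSum.IsInternal G) {f g : M →ₗ[R] C} (h : ∀ i, ∀ x ∈ G i, f x = g x) :
    f = g := by
  have : ⨆ i, G i ≤ LinearMap.eqLocus f g := iSup_le h
  rw [hG.submodule_iSup_eq_top] at this
  exact LinearMap.ext fun x => this trivial

/-! ### Contraction of maps out of projective flags -/

namespace GrFlag

variable {R : Type u} [CommRing R] {d : ℕ}

theorem filPred_le_fil (F : GrFlag.{u, v} R d) (n : ℕ) (k : ZMod d) :
    F.filPred n k ≤ F.fil n k := by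
  cases n with
  | zero => exact bot_le
  | succ n => exact F.fil_le_succ n k

theorem fil_mono (F : GrFlag.{u, v} R d) (k : ZMod d) : Monotone fun n => F.fil n k :=
  monotone_nat_of_le_succ fun n => F.fil_le_succ n k

theorem filPred_mono (F : GrFlag.{u, v} R d) (k : ZMod d) : Monotone fun n => F.filPred n k :=
  monotone_nat_of_le_succ fun n => F.filPred_le_fil n k

theorem diff_fil (F : GrFlag.{u, v} R d) (n : ℕ) (k : ZMod d) :
    ∀ x ∈ F.fil n k, F.diff x ∈ F.filPred n (k - 1) :=
  F.diff_filPred_succ n k (k - 1) (by ring)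

theorem diff_filPred (F : GrFlag.{u, v} R d) (n : ℕ) (k : ZMod d) :
    ∀ x ∈ F.filPred n k, F.diff x ∈ F.filPred n (k - 1) :=
  fun x hx => F.diff_fil n k x (F.filPred_le_fil n k hx)

/-- A map `g` (commuting with the differentials up to the factor `σ`) from a projective flag to a
differential module `C` with families of submodules `A`, `B` such that cycles in `A n k` bound
elements of `B (n + 1) k`, is null-homotopic, compatibly with these families. -/
theorem IsProjective.exists_contraction {F : GrFlag.{u, v} R d} (hF : F.IsProjective)
    {C : Type*} [AddCommGroup C] [Module R C] (δ : C →ₗ[R] C) (σ : R)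
    (A B : ℕ → ZMod d → Submodule R C) (g : F.carrier →ₗ[R] C)
    (hg : ∀ x, δ (g x) = σ • g (F.diff x)) (hgA : ∀ n k, ∀ x ∈ F.fil n k, g x ∈ A n k)
    (hBA : ∀ n k, B n (k - 1) ≤ A n k) (hB : ∀ n k, B n k ≤ B (n + 1) k)
    (hAB : ∀ n k, ∀ c ∈ A n k, δ c = 0 → c ∈ (B (n + 1) k).map δ) :
    ∃ H : F.carrier →ₗ[R] C, (∀ n k, ∀ x ∈ F.fil n k, H x ∈ B (n + 1) k) ∧
      ∀ x, g x = δ (H x) + σ • H (F.diff x) := by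
  -- Stage `n` is a contraction on `F^{n-1}` in all degrees at once; indexing by `filPred` lets the
  -- induction start from the zero module.
  let P : ∀ n, (∀ k, F.filPred n k →ₗ[R] C) → Prop := fun n f =>
    (∀ k x, f k x ∈ B n k) ∧
    ∀ k (x : F.filPred n k), g x = δ (f k x) + σ • f (k - 1) ⟨F.diff x, F.diff_filPred n k x x.2⟩
  have step : ∀ n (f : {f // P n f}), ∃ f' : {f // P (n + 1) f},
      ∀ k (x : F.filPred n k), f'.1 k ⟨x, F.filPred_le_fil n k x.2⟩ = f.1 k x := by
    rintro n ⟨f, hfB, hf⟩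
    have ext : ∀ k, ∃ f' : F.fil n k →ₗ[R] C,
        (∀ x : F.filPred n k, f' ⟨x, F.filPred_le_fil n k x.2⟩ = f k x) ∧
        (∀ x, f' x ∈ B (n + 1) k) ∧
        ∀ x : F.fil n k, δ (f' x) = g x - σ • f (k - 1) ⟨F.diff x, F.diff_fil n k x x.2⟩ := by
      intro k
      have := hF n k
      obtain ⟨f', h₁, h₂, h₃⟩ := LinearMap.exists_lift_extending
        ((F.filPred n k).submoduleOf (F.fil n k)) (B (n + 1) k) δ
        (g ∘ₗ (F.fil n k).subtype - σ • (f (k - 1) ∘ₗ F.diff.restrict (F.diff_fil n k)))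
        (f k ∘ₗ ((F.fil n k).subtype ∘ₗ Submodule.subtype _).codRestrict _ fun x => x.2)
        (fun x => hB n k (hfB k _))
        (fun x => by
          refine hAB n k _ (sub_mem (hgA n k _ x.2)
            (Submodule.smul_mem _ _ (hBA n k (hfB _ _)))) ?_
          -- The right-hand side `g x - σ f(dx)` is a cycle: the stage `n` identity at `dx` gives `δ
          -- f(dx) = g(dx)`, because `d² = 0`.
          have h := hf (k - 1) ⟨F.diff x, F.diff_fil n k x x.2⟩
          have h0 : (⟨F.diff (F.diff x),
              F.diff_filPred n (k - 1) _ (F.diff_fil n k x x.2)⟩ : F.filPred n (k - 1 - 1)) = 0 :=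
            Subtype.ext (F.diff_diff x)
          simp only [h0, map_zero, smul_zero, add_zero] at h
          simp only [LinearMap.sub_apply, LinearMap.comp_apply, LinearMap.smul_apply, map_sub,
            map_smul, Submodule.subtype_apply, hg, h]
          exact sub_self _)
        (fun x => by
          have h := hf k ⟨x, x.2⟩
          exact (sub_eq_of_eq_add h).symm)
      exact ⟨f', fun x => h₁ ⟨⟨x, F.filPred_le_fil n k x.2⟩, x.2⟩, h₂, h₃⟩
    choose f' h₁ h₂ h₃ using ext
    refine ⟨⟨f', h₂, fun k x => ?_⟩, fun k x => h₁ k x⟩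
    have h := h₁ (k - 1) ⟨F.diff x, F.diff_fil n k x x.2⟩
    exact (sub_eq_iff_eq_add.1 (h₃ k x).symm).trans
      (congrArg (fun z => δ (f' k x) + σ • z) h.symm)
  choose next hnext using step
  have h0 : P 0 fun k => 0 := by
    refine ⟨fun k x => zero_mem _, fun k x => ?_⟩
    have hx : (x : F.carrier) = 0 := (Submodule.mem_bot R).1 x.2
    simp [hx]
  let f : ∀ n, {f // P n f} := fun n => Nat.rec ⟨_, h0⟩ next n
  have hf : ∀ n k (x : F.filPred n k), (f (n + 1)).1 k ⟨x, F.filPred_le_fil n k x.2⟩ = (f n).1 k x :=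
    fun n => hnext n (f n)
  have glue := fun k => Submodule.exists_glue_of_monotone (F.grade k) (fun n => F.filPred n k)
    (F.filPred_mono k) (fun x hx => (F.exhaustive k x hx).imp' Nat.succ fun _ h => h)
    (fun n => (f n).1 k) (fun n x => hf n k x)
  choose Hk hHk using glue
  obtain ⟨H, hH⟩ := F.isInternal.exists_glue Hk
  have hHf : ∀ n k (x : F.filPred n k), H x = (f n).1 k x := fun n k x => by
    have hx : (x : F.carrier) ∈ F.grade k := F.fil_le_grade n k (F.filPred_le_fil n k x.2)
    rw [hH k ⟨x, hx⟩, hHk k n ⟨x, hx⟩ x.2]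
  refine ⟨H, fun n k x hx => ?_, fun x => ?_⟩
  · rw [hHf (n + 1) k ⟨x, hx⟩]
    exact (f (n + 1)).2.1 k _
  · have : g = δ ∘ₗ H + σ • (H ∘ₗ F.diff) := F.isInternal.linearMap_ext fun k x hx => by
      obtain ⟨n, hn⟩ := F.exhaustive k x hx
      have h := (f (n + 1)).2.2 k ⟨x, hn⟩
      exact h.trans (congrArg₂ (fun a b => δ a + σ • b) (hHf (n + 1) k ⟨x, hn⟩).symm
        (hHf (n + 1) (k - 1) ⟨F.diff x, F.diff_filPred (n + 1) k x hn⟩).symm)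
    exact LinearMap.congr_fun this x

end GrFlag

/-! ### Homotopies, mapping cones, and quasi-isomorphisms in terms of elements -/

namespace GrDiffMod

variable {R : Type u} [CommRing R] {d : ℕ} {D D' D'' : GrDiffMod.{u, v} R d}

theorem Homotopic.trans {f g h : Hom D D'} (hfg : Homotopic f g) (hgh : Homotopic g h) :
    Homotopic f h := by
  obtain ⟨a, ha, ha'⟩ := hfg
  obtain ⟨b, hb, hb'⟩ := hgh
  refine ⟨a + b, fun j x hx => add_mem (ha j x hx) (hb j x hx), fun x => ?_⟩
  rw [← sub_add_sub_cancel _ (g.toLin x), ha', hb']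
  simp only [LinearMap.add_apply, map_add]
  abel

theorem Homotopic.comp_right {f g : Hom D' D''} (hfg : Homotopic f g) (e : Hom D D') :
    Homotopic (f.comp e) (g.comp e) := by
  obtain ⟨a, ha, ha'⟩ := hfg
  refine ⟨a ∘ₗ e.toLin, fun j x hx => ha j _ (e.map_mem j x hx), fun x => ?_⟩
  simpa [e.comm, Hom.comp] using ha' (e.toLin x)

theorem Hom.comp_sub_comp_comm (f g : Hom D D') (x : D.carrier) :
    D'.diff (f.toLin x - g.toLin x) = f.toLin (D.diff x) - g.toLin (D.diff x) := by
  rw [map_sub, f.comm, g.comm]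

/-- The differential of the mapping cone of a morphism. -/
def Hom.coneDiff (f : Hom D D') : D.carrier × D'.carrier →ₗ[R] D.carrier × D'.carrier :=
  (D.diff ∘ₗ LinearMap.fst R _ _).prod
    (f.toLin ∘ₗ LinearMap.fst R _ _ - D'.diff ∘ₗ LinearMap.snd R _ _)

@[simp]
theorem Hom.coneDiff_apply (f : Hom D D') (y : D.carrier) (w : D'.carrier) :
    f.coneDiff (y, w) = (D.diff y, f.toLin y - D'.diff w) :=
  rfl

theorem Hom.IsQuasiIso.mem_boundaries {f : Hom D D'} (hf : f.IsQuasiIso) {j : ZMod d}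
    {x : D.carrier} (hx : x ∈ D.cycles j) (hfx : f.toLin x ∈ D'.boundaries j) :
    x ∈ D.boundaries j := by
  have h : f.homologyMap j (Submodule.Quotient.mk ⟨x, hx⟩) = 0 :=
    (Submodule.Quotient.mk_eq_zero _).2 hfx
  rw [← map_zero (f.homologyMap j)] at h
  exact (Submodule.Quotient.mk_eq_zero ((D.boundaries j).submoduleOf _)).1 ((hf j).1 h)

theorem Hom.IsQuasiIso.exists_sub_mem_boundaries {f : Hom D D'} (hf : f.IsQuasiIso) {j : ZMod d}
    {y : D'.carrier} (hy : y ∈ D'.cycles j) :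
    ∃ x ∈ D.cycles j, f.toLin x - y ∈ D'.boundaries j := by
  obtain ⟨x, hx⟩ := (hf j).2 (Submodule.Quotient.mk ⟨y, hy⟩)
  obtain ⟨x, rfl⟩ := Submodule.Quotient.mk_surjective _ x
  exact ⟨x, x.2, (Submodule.Quotient.eq ((D'.boundaries j).submoduleOf _)).1 hx⟩

theorem Hom.isQuasiIso_of_mem_boundaries {f : Hom D D'}
    (hinj : ∀ j, ∀ x ∈ D.cycles j, f.toLin x ∈ D'.boundaries j → x ∈ D.boundaries j)
    (hsurj : ∀ j, ∀ y ∈ D'.cycles j, ∃ x ∈ D.cycles j, f.toLin x - y ∈ D'.boundaries j) :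
    f.IsQuasiIso := by
  refine fun j => ⟨(injective_iff_map_eq_zero _).2 fun x hx => ?_, fun y => ?_⟩
  · obtain ⟨x, rfl⟩ := Submodule.Quotient.mk_surjective _ x
    exact (Submodule.Quotient.mk_eq_zero _).2
      (hinj j x x.2
        ((Submodule.Quotient.mk_eq_zero ((D'.boundaries j).submoduleOf _)).1 hx))
  · obtain ⟨y, rfl⟩ := Submodule.Quotient.mk_surjective _ y
    obtain ⟨x, hx, h⟩ := hsurj j y y.2
    exact ⟨Submodule.Quotient.mk ⟨x, hx⟩, (Submodule.Quotient.eq _).2 h⟩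

end GrDiffMod

/-! ### Filtered acyclicity of anchored resolutions -/

namespace GrFlag

open GrDiffMod

variable {R : Type u} [CommRing R] {d : ℕ}

/-- The mapping cone of `ε : F → D` is acyclic in the filtered sense: every cycle `(a, b)` of the
cone with `a` in filtration `n - 1` is the boundary of some `(y, w)` with `y` in filtration `n`. -/
def FilteredAcyclic (F : GrFlag.{u, v} R d) {D : GrDiffMod.{u, v} R d}
    (ε : Hom F.toGrDiffMod D) : Prop :=
  ∀ n k, ∀ a ∈ F.filPred n (k - 1), ∀ b ∈ D.grade k, F.diff a = 0 → ε.toLin a = D.diff b →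
    ∃ y ∈ F.fil n k, ∃ w ∈ D.grade (k + 1), F.diff y = a ∧ ε.toLin y - D.diff w = b

/-- Exactness of the anchor in positive degrees, in terms of elements. -/
theorem exists_sub_diff_mem {F : GrFlag.{u, v} R d}
    (hF : ∀ j i, Function.Exact (F.anchorDiff j (i + 1)) (F.anchorDiff j i)) {i : ℕ} {k : ZMod d}
    {x : F.carrier} (hx : x ∈ F.fil (i + 1) k) (hdx : F.diff x ∈ F.filPred i (k - 1)) :
    ∃ z ∈ F.fil (i + 2) (k + 1), x - F.diff z ∈ F.fil i k := by
  obtain ⟨j, rfl⟩ : ∃ j, k = ((i + 1 : ℕ) : ZMod d) + j := ⟨k - (i + 1 : ℕ), by ring⟩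
  have h₁ : ((i + 1 : ℕ) : ZMod d) + j - 1 = i + j := by push_cast; ring
  have h₂ : ((i + 1 : ℕ) : ZMod d) + j + 1 = (i + 2 : ℕ) + j := by push_cast; ring
  rw [h₁] at hdx
  rw [h₂]
  have h0 : F.anchorDiff j i (Submodule.Quotient.mk ⟨x, hx⟩) = 0 :=
    (Submodule.Quotient.mk_eq_zero _).2 hdx
  obtain ⟨z, hz⟩ := (hF j i _).1 h0
  obtain ⟨z, rfl⟩ := Submodule.Quotient.mk_surjective _ z
  refine ⟨z, z.2, ?_⟩
  rw [← neg_sub]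
  exact neg_mem ((Submodule.Quotient.eq ((F.filPred (i + 1) _).submoduleOf _)).1 hz)

/-- A boundary in filtration `n - 1` is the boundary of an element in filtration `n`. -/
theorem exists_diff_eq_of_mem_filPred {F : GrFlag.{u, v} R d}
    (hF : ∀ j i, Function.Exact (F.anchorDiff j (i + 1)) (F.anchorDiff j i)) {n : ℕ} {k : ZMod d}
    (m : ℕ) {y : F.carrier} (hy : y ∈ F.fil m k) (hdy : F.diff y ∈ F.filPred n (k - 1)) :
    ∃ y' ∈ F.fil n k, F.diff y' = F.diff y := by
  induction m generalizing y with
  | zero => exact ⟨y, F.fil_mono k n.zero_le hy, rfl⟩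
  | succ m ih =>
    rcases le_or_gt (m + 1) n with h | h
    · exact ⟨y, F.fil_mono k h hy, rfl⟩
    -- While `y` lies too high, its boundary vanishes in the anchor, so subtracting some `dz` lowers
    -- `y` by one step and leaves `dy` unchanged.
    · obtain ⟨z, -, hz⟩ := exists_sub_diff_mem hF hy (F.filPred_mono _ (Nat.lt_succ_iff.1 h) hdy)
      have hd : F.diff (y - F.diff z) = F.diff y := by rw [map_sub, F.diff_diff, sub_zero]
      simpa only [hd] using ih hz (by rwa [hd])

/-- Every cycle is homologous to one in filtration `0`. -/
theorem exists_sub_diff_mem_fil_zero {F : GrFlag.{u, v} R d}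
    (hF : ∀ j i, Function.Exact (F.anchorDiff j (i + 1)) (F.anchorDiff j i)) {k : ZMod d}
    (m : ℕ) {y : F.carrier} (hy : y ∈ F.fil m k) (hdy : F.diff y = 0) :
    ∃ z ∈ F.grade (k + 1), y - F.diff z ∈ F.fil 0 k := by
  induction m generalizing y with
  | zero => exact ⟨0, zero_mem _, by simpa using hy⟩
  | succ m ih =>
    obtain ⟨z, hz, hyz⟩ := exists_sub_diff_mem hF hy (by rw [hdy]; exact zero_mem _)
    obtain ⟨z', hz', h⟩ := ih hyz (by rw [map_sub, F.diff_diff, hdy, sub_zero])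
    refine ⟨z + z', add_mem (F.fil_le_grade _ _ hz) hz', ?_⟩
    rwa [map_add, ← sub_sub]

/-- Injectivity of `ε` on homology makes `a` a boundary, and anchor exactness moves the bounding
element `y` into `F^n`. The remaining error `ε y - b` is a cycle of `D`; by surjectivity it is
homologous to the image of a cycle, which can be moved into `F^0` and subtracted from `y` without
leaving `F^n`. -/
theorem filteredAcyclic_of_isQuasiIso {F : GrFlag.{u, v} R d} {D : GrDiffMod.{u, v} R d}
    {ε : Hom F.toGrDiffMod D} (hε : ε.IsQuasiIso)
    (hF : ∀ j i, Function.Exact (F.anchorDiff j (i + 1)) (F.anchorDiff j i)) :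
    F.FilteredAcyclic ε := by
  intro n k a ha b hb hda hab
  have hk : k - 1 + 1 = k := by ring
  obtain ⟨y₀, hy₀, rfl⟩ : a ∈ F.boundaries (k - 1) := hε.mem_boundaries
    ⟨F.fil_le_grade _ _ (F.filPred_le_fil _ _ ha), hda⟩ ⟨b, by rwa [hk], hab.symm⟩
  rw [hk] at hy₀
  obtain ⟨m, hm⟩ := F.exhaustive k y₀ hy₀
  obtain ⟨y, hy, hdy⟩ := exists_diff_eq_of_mem_filPred hF m hm ha
  obtain ⟨c, hc, w, hw, hcw⟩ := hε.exists_sub_mem_boundaries (y := ε.toLin y - b) (j := k)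
    ⟨sub_mem (ε.map_mem k y (F.fil_le_grade _ _ hy)) hb, by
      change D.diff _ = 0
      rw [map_sub, ε.comm, hdy, hab, sub_self]⟩
  obtain ⟨m, hm⟩ := F.exhaustive k c hc.1
  obtain ⟨z, hz, hcz⟩ := exists_sub_diff_mem_fil_zero hF m hm hc.2
  have hdc : F.diff c = 0 := hc.2
  refine ⟨y - (c - F.diff z), sub_mem hy (F.fil_mono k n.zero_le hcz), ε.toLin z - w,
    sub_mem (ε.map_mem _ z hz) hw, ?_, ?_⟩
  · rw [map_sub, map_sub, F.diff_diff, hdc, hdy, sub_zero, sub_zero]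
  · rw [map_sub D.diff, hcw, map_sub, map_sub, ε.comm]
    abel

/-! ### Lifting and uniqueness up to flag-preserving homotopy -/

/-- Lifting of a morphism from a projective flag along a filtered acyclic augmentation. -/
theorem IsProjective.exists_lift {F F' : GrFlag.{u, v} R d} (hF : F.IsProjective)
    {D : GrDiffMod.{u, v} R d} {ε : Hom F'.toGrDiffMod D} (hε : F'.FilteredAcyclic ε)
    (φ : Hom F.toGrDiffMod D) :
    ∃ ψ : Hom F.toGrDiffMod F'.toGrDiffMod, FlagPreserving ψ ∧ Homotopic (ε.comp ψ) φ := by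
  -- The sign is `-1` because `w` enters the cone differential as `-dw`. The first component of the
  -- contraction identity says that the lift is a chain map, the second is the homotopy.
  obtain ⟨H, hH, h⟩ := hF.exists_contraction ε.coneDiff (-1)
    (fun n k => (F'.filPred n (k - 1)).prod (D.grade k))
    (fun n k => (F'.filPred n k).prod (D.grade (k + 1)))
    (LinearMap.inr R F'.carrier D.carrier ∘ₗ φ.toLin)
    (fun x => by simp [φ.comm])
    (fun n k x hx => ⟨zero_mem _, φ.map_mem k x (F.fil_le_grade n k hx)⟩)
    (fun n k => by simp)
    (fun n k => Submodule.prod_mono (F'.filPred_mono k n.le_succ) le_rfl)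
    (by
      rintro n k ⟨a, b⟩ ⟨ha, hb⟩ hab
      obtain ⟨h₁, h₂⟩ := Prod.ext_iff.1 hab
      obtain ⟨y, hy, w, hw, rfl, rfl⟩ := hε n k a ha b hb h₁ (sub_eq_zero.1 h₂)
      exact ⟨(y, w), ⟨hy, hw⟩, rfl⟩)
  have h₁ : ∀ x, F'.diff (H x).1 = (H (F.diff x)).1 := fun x => by
    have := congrArg Prod.fst (h x)
    exact (sub_eq_zero.1 (by simpa [Hom.coneDiff, sub_eq_add_neg] using this.symm))
  have h₂ : ∀ x, ε.toLin (H x).1 - φ.toLin x = D.diff (H x).2 + (H (F.diff x)).2 := fun x => by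
    have h := congrArg Prod.snd (h x)
    have h : φ.toLin x = ε.toLin (H x).1 - D.diff (H x).2 - (H (F.diff x)).2 := by
      simpa [Hom.coneDiff, sub_eq_add_neg] using h
    rw [h]
    abel
  refine ⟨⟨LinearMap.fst R _ _ ∘ₗ H, fun k x hx => ?_, h₁⟩, fun n k x hx => (hH n k x hx).1,
    LinearMap.snd R _ _ ∘ₗ H, fun k x hx => ?_, h₂⟩
  · obtain ⟨n, hn⟩ := F.exhaustive k x hx
    exact F'.fil_le_grade n k (hH n k x hn).1
  · obtain ⟨n, hn⟩ := F.exhaustive k x hx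
    exact (hH n k x hn).2

/-- Flag-preserving morphisms from a projective flag that become homotopic after composition with
a filtered acyclic augmentation are homotopic by a flag-preserving homotopy. -/
theorem IsProjective.flagHomotopic {F F' : GrFlag.{u, v} R d} (hF : F.IsProjective)
    {D : GrDiffMod.{u, v} R d} {ε : Hom F'.toGrDiffMod D} (hε : F'.FilteredAcyclic ε)
    {f g : Hom F.toGrDiffMod F'.toGrDiffMod} (hf : FlagPreserving f) (hg : FlagPreserving g)
    (hfg : Homotopic (ε.comp f) (ε.comp g)) : FlagHomotopic f g := by
  obtain ⟨s, hs, hs'⟩ := hfg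
  have hs'' : ∀ x, ε.toLin (f.toLin x - g.toLin x) = D.diff (s x) + s (F.diff x) := fun x => by
    rw [map_sub]; exact hs' x
  -- The homotopy relation for `s` says exactly that `(f - g, s)` commutes with the differentials,
  -- now with sign `1`.
  obtain ⟨H, hH, h⟩ := hF.exists_contraction ε.coneDiff 1
    (fun n k => (F'.fil n k).prod (D.grade (k + 1)))
    (fun n k => (F'.fil n (k + 1)).prod (D.grade (k + 1 + 1)))
    ((f.toLin - g.toLin).prod s)
    (fun x => by
      rw [one_smul]
      refine Prod.ext (f.comp_sub_comp_comm g x) ?_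
      exact (congrArg (· - _) (hs'' x)).trans (add_sub_cancel_left _ _))
    (fun n k x hx => ⟨sub_mem (hf n k x hx) (hg n k x hx), hs k x (F.fil_le_grade n k hx)⟩)
    (fun n k => by simp)
    (fun n k => Submodule.prod_mono (F'.fil_le_succ n _) le_rfl)
    (by
      rintro n k ⟨a, b⟩ ⟨ha, hb⟩ hab
      obtain ⟨h₁, h₂⟩ := Prod.ext_iff.1 hab
      obtain ⟨y, hy, w, hw, rfl, rfl⟩ :=
        hε (n + 1) (k + 1) a (by rwa [add_sub_cancel_right]) b hb h₁ (sub_eq_zero.1 h₂)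
      exact ⟨(y, w), ⟨hy, hw⟩, rfl⟩)
  refine ⟨LinearMap.fst R _ _ ∘ₗ H, fun n k x hx => (hH n k x hx).1, fun x => ?_⟩
  have h := congrArg Prod.fst (h x)
  rw [one_smul] at h
  exact h

end GrFlag

namespace AnchoredResolution

variable {R : Type u} [CommRing R] {d : ℕ} {D D' : GrDiffMod.{u, v} R d}

open GrDiffMod GrFlag

theorem filteredAcyclic (F : AnchoredResolution D) : F.flag.FilteredAcyclic F.aug :=
  filteredAcyclic_of_isQuasiIso F.isQuasiIso fun j => (F.anchorResolves j).2.1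

theorem exists_lift (φ : Hom D D') (F : AnchoredResolution D) (F' : AnchoredResolution D') :
    ∃ ψ : Hom F.flag.toGrDiffMod F'.flag.toGrDiffMod,
      FlagPreserving ψ ∧ Homotopic (F'.aug.comp ψ) (φ.comp F.aug) :=
  F.isProjective.exists_lift F'.filteredAcyclic _

theorem flagHomotopic_id (F : AnchoredResolution D)
    {f : Hom F.flag.toGrDiffMod F.flag.toGrDiffMod} (hf : FlagPreserving f)
    (h : Homotopic (F.aug.comp f) F.aug) : FlagHomotopic f (Hom.id F.flag.toGrDiffMod) :=
  F.isProjective.flagHomotopic F.filteredAcyclic hf (fun _ _ _ hx => hx) h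

/-- Lift the identity of `D` both ways. After augmentation each composite is homotopic to the
augmentation itself, so uniqueness of lifts makes it flag-homotopic to the identity. -/
theorem flagHomotopyEquivalent (F F' : AnchoredResolution D) :
    FlagHomotopyEquivalent F.flag F'.flag := by
  obtain ⟨f, hf, hf'⟩ := exists_lift (Hom.id D) F F'
  obtain ⟨g, hg, hg'⟩ := exists_lift (Hom.id D) F' F
  exact ⟨f, g, hf, hg,
    F.flagHomotopic_id (fun n k x hx => hg n k _ (hf n k x hx)) ((hg'.comp_right f).trans hf'),
    F'.flagHomotopic_id (fun n k x hx => hf n k _ (hg n k x hx)) ((hf'.comp_right g).trans hg')⟩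

end AnchoredResolution

/-! ### From filtered acyclicity back to anchored resolutions -/

namespace GrFlag

open GrDiffMod

variable {R : Type u} [CommRing R] {d : ℕ} {F : GrFlag.{u, v} R d} {D : GrDiffMod.{u, v} R d}
  {ε : Hom F.toGrDiffMod D}

/-- Injectivity forgets the filtration bound; surjectivity uses the cone cycle `(0, y)`. -/
theorem FilteredAcyclic.isQuasiIso (hε : F.FilteredAcyclic ε) : ε.IsQuasiIso := by
  refine Hom.isQuasiIso_of_mem_boundaries (fun j x hx => ?_) fun j y hy => ?_
  · rintro ⟨b, hb, hb'⟩
    obtain ⟨n, hn⟩ := F.exhaustive j x hx.1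
    obtain ⟨y, hy, -, -, hyx, -⟩ := hε (n + 1) (j + 1) x (by rwa [add_sub_cancel_right]) b hb hx.2
      hb'.symm
    exact ⟨y, F.fil_le_grade _ _ hy, hyx⟩
  · have hdy : D.diff y = 0 := hy.2
    obtain ⟨x, hx, w, hw, hdx, h⟩ := hε 0 j 0 (zero_mem _) y hy.1 (map_zero _)
      (by rw [hdy, map_zero])
    exact ⟨x, ⟨F.fil_le_grade _ _ hx, hdx⟩, w, hw, by rw [← h, sub_sub_cancel]⟩

theorem FilteredAcyclic.exact_grDiff (hε : F.FilteredAcyclic ε) (i : ℕ) {k₂ k₁ k₀ : ZMod d}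
    (h₂ : k₂ = k₁ + 1) (h₁ : k₁ = k₀ + 1) :
    Function.Exact (F.grDiff (i + 1) k₂ k₁ h₂) (F.grDiff i k₁ k₀ h₁) := by
  subst h₂
  have hk : k₀ = k₁ - 1 := by rw [h₁, add_sub_cancel_right]
  intro x
  obtain ⟨⟨x, hx⟩, rfl⟩ := Submodule.Quotient.mk_surjective _ x
  constructor
  · intro h
    have hdx : F.diff x ∈ F.filPred i (k₁ - 1) := by
      rw [← hk]
      exact (Submodule.Quotient.mk_eq_zero ((F.filPred i k₀).submoduleOf _)).1 h
    -- The cone cycle `(dx, ε x)` bounds some `(x', w)` with `x'` one step lower than `x`. The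
    -- difference `(x - x', -w)` is again a cone cycle, so `x - x'` is a boundary and `x` is one
    -- modulo `F^i`.
    obtain ⟨x', hx', w, hw, hdx', hw'⟩ := hε i k₁ (F.diff x) hdx (ε.toLin x)
      (ε.map_mem _ x (F.fil_le_grade _ _ hx)) (F.diff_diff x) (ε.comm x).symm
    obtain ⟨y, hy, -, -, hdy, -⟩ := hε (i + 2) (k₁ + 1) (x - x')
      (by rw [add_sub_cancel_right]; exact sub_mem hx (F.fil_le_succ _ _ hx')) (-w) (neg_mem hw)
      (by rw [map_sub, hdx', sub_self]) (by rw [map_sub, ← hw', map_neg, sub_sub_cancel_left])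
    refine ⟨Submodule.Quotient.mk ⟨y, hy⟩,
      (Submodule.Quotient.eq ((F.filPred (i + 1) k₁).submoduleOf _)).2 ?_⟩
    change F.diff y - x ∈ F.fil i k₁
    rw [hdy, sub_sub_cancel_left]
    exact neg_mem hx'
  · rintro ⟨y, hy⟩
    obtain ⟨⟨y, hy'⟩, rfl⟩ := Submodule.Quotient.mk_surjective _ y
    rw [← hy]
    refine (Submodule.Quotient.mk_eq_zero ((F.filPred i k₀).submoduleOf _)).2 ?_
    change F.diff (F.diff y) ∈ F.filPred i k₀
    rw [F.diff_diff]
    exact zero_mem _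

/-- The map is induced by `ε` on `F^0`, which consists of cycles. Filtered acyclicity at `n = 0`
gives surjectivity and at `n = 1` exactness. -/
theorem FilteredAcyclic.exists_augmentation (hε : F.FilteredAcyclic ε) {k₁ k₀ j : ZMod d}
    (h : k₁ = k₀ + 1) (hj : k₀ = j) :
    ∃ π : F.gr 0 k₀ →ₗ[R] D.homology j,
      Function.Exact (F.grDiff 0 k₁ k₀ h) π ∧ Function.Surjective π := by
  subst hj h
  have hcyc : ∀ x ∈ F.fil 0 k₀, ε.toLin x ∈ D.cycles k₀ := fun x hx =>
    ε.map_cycles k₀ x ⟨F.fil_le_grade _ _ hx, F.diff_fil_zero _ x hx⟩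
  refine ⟨Submodule.mapQ _ _ (ε.toLin.restrict hcyc) ?_, fun x => ?_, fun y => ?_⟩
  · intro x hx
    have hx0 : (x : F.carrier) = 0 := hx
    change ε.toLin x ∈ D.boundaries k₀
    rw [hx0, map_zero]
    exact zero_mem _
  · obtain ⟨⟨x, hx⟩, rfl⟩ := Submodule.Quotient.mk_surjective _ x
    constructor
    · intro h
      obtain ⟨w, hw, hwx⟩ : ε.toLin x ∈ D.boundaries k₀ :=
        (Submodule.Quotient.mk_eq_zero ((D.boundaries k₀).submoduleOf _)).1 h
      obtain ⟨y, hy, -, -, hdy, -⟩ := hε 1 (k₀ + 1) x (by rwa [add_sub_cancel_right]) w hw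
        (F.diff_fil_zero _ x hx) hwx.symm
      exact ⟨Submodule.Quotient.mk ⟨y, hy⟩, congrArg _ (Subtype.ext hdy)⟩
    · rintro ⟨y, hy⟩
      obtain ⟨⟨y, hy'⟩, rfl⟩ := Submodule.Quotient.mk_surjective _ y
      rw [← hy]
      exact (Submodule.Quotient.mk_eq_zero ((D.boundaries k₀).submoduleOf _)).2
        ⟨ε.toLin y, ε.map_mem _ y (F.fil_le_grade _ _ hy'), ε.comm y⟩
  · obtain ⟨⟨y, hy⟩, rfl⟩ := Submodule.Quotient.mk_surjective _ y
    have hdy : D.diff y = 0 := hy.2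
    obtain ⟨x, hx, w, hw, -, h⟩ := hε 0 k₀ 0 (zero_mem _) y hy.1 (map_zero _)
      (by rw [hdy, map_zero])
    refine ⟨Submodule.Quotient.mk ⟨x, hx⟩,
      (Submodule.Quotient.eq ((D.boundaries k₀).submoduleOf _)).2 ⟨w, hw, ?_⟩⟩
    change D.diff w = ε.toLin x - y
    rw [← h, sub_sub_cancel]

end GrFlag

/-- A projective flag with a filtered acyclic augmentation is an anchored resolution. -/
def AnchoredResolution.ofFilteredAcyclic {R : Type u} [CommRing R] {d : ℕ}
    {D : GrDiffMod.{u, v} R d} (F : GrFlag.{u, v} R d) (hF : F.IsProjective)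
    (ε : GrDiffMod.Hom F.toGrDiffMod D) (hε : F.FilteredAcyclic ε) : AnchoredResolution D where
  flag := F
  aug := ε
  isQuasiIso := hε.isQuasiIso
  isProjective := hF
  anchorResolves _ := ⟨fun _ => hF _ _, fun _ => hε.exact_grDiff _ _ _,
    hε.exists_augmentation _ (by simp)⟩

/-- A flag is projective if `F^{n-1}_k` is the kernel of a surjection from `F^n_k` onto a
projective module. -/
theorem GrFlag.IsProjective.of_exists_surjective {R : Type u} [CommRing R] {d : ℕ}
    {F : GrFlag.{u, v} R d} (N : ℕ → ZMod d → Type*) [∀ n k, AddCommGroup (N n k)]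
    [∀ n k, Module R (N n k)] [∀ n k, Module.Projective R (N n k)]
    (h : ∀ n k, ∃ f : F.fil n k →ₗ[R] N n k, Function.Surjective f ∧
      ∀ x, f x = 0 ↔ (x : F.carrier) ∈ F.filPred n k) : F.IsProjective := by
  intro n k
  obtain ⟨f, hf, hf'⟩ := h n k
  have hK : (F.filPred n k).submoduleOf (F.fil n k) = LinearMap.ker f :=
    Submodule.ext fun x => (hf' x).symm
  exact Module.Projective.of_equiv
    (Submodule.quotEquivOfEq _ _ hK ≪≫ₗ f.quotKerEquivOfSurjective hf).symm

/-! ### Submodules of a free module spanned by subsets of the basis -/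

namespace Finsupp

variable {R α : Type*} [CommRing R]

theorem exists_eq_sum_single (a : α →₀ R) :
    ∃ (n : ℕ) (c : Fin n → R) (x : Fin n → α),
      (∀ i, x i ∈ a.support) ∧ a = ∑ i, single (x i) (c i) := by
  let e := a.support.equivFin.symm
  refine ⟨_, fun i => a (e i), fun i => e i, fun i => (e i).2, ?_⟩
  rw [e.sum_comp fun x : a.support => single (x : α) (a x), Finset.sum_coe_sort a.support
    fun x => single x (a x)]
  exact a.sum_single.symm

theorem linearCombination_mem_of_mem_supported {M : Type*} [AddCommGroup M] [Module R M]
    {v : α → M} {S : Set α} {N : Submodule R M} (h : ∀ p ∈ S, v p ∈ N) {a : α →₀ R}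
    (ha : a ∈ supported R R S) : linearCombination R v a ∈ N := by
  rw [linearCombination_apply]
  exact N.sum_mem fun p hp => N.smul_mem _ (h p (ha hp))

theorem isInternal_supported_fiber {ι : Type*} [DecidableEq ι] (f : α → ι) :
    DirectSum.IsInternal fun i => supported R R {p | f p = i} := by
  refine DirectSum.isInternal_submodule_of_iSupIndep_of_iSup_eq_top (fun i => ?_) ?_
  · have hd : Disjoint {p | f p = i} {p | f p ≠ i} :=
      Set.disjoint_left.2 fun p hp hp' => hp' hp
    have h : ⨆ (j) (_ : j ≠ i), supported R R {p | f p = j} ≤ supported R R {p | f p ≠ i} :=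
      iSup₂_le fun j hj => supported_mono fun p hp hp' => hj (hp.symm.trans hp')
    exact (disjoint_supported_supported hd).mono_right h
  · rw [← supported_iUnion, ← supported_univ]
    congr 1
    exact Set.eq_univ_of_forall fun p => Set.mem_iUnion.2 ⟨f p, rfl⟩

theorem exists_surjective_supported_diff {S T : Set α} :
    ∃ f : supported R R S →ₗ[R] supported R R (S \ T), Function.Surjective f ∧
      ∀ x, f x = 0 ↔ (x : α →₀ R) ∈ supported R R T := by
  classical
  refine ⟨restrictDom R R (S \ T) ∘ₗ Submodule.subtype _, fun x => ?_, fun x => ?_⟩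
  · exact ⟨⟨x, supported_mono Set.sdiff_subset x.2⟩,
      LinearMap.congr_fun (restrictDom_comp_subtype (R := R) (M := R) (S \ T)) x⟩
  · rw [mem_supported', ← Subtype.coe_inj, DFunLike.ext_iff]
    refine forall_congr' fun p => ?_
    have hx := (mem_supported' R _).1 x.2 p
    by_cases hS : p ∈ S <;> by_cases hT : p ∈ T <;>
      simp_all [restrictDom_apply]

end Finsupp

/-! ### The free flag on formal cells -/

namespace GrDiffMod

variable {R : Type u} [CommRing R] {d : ℕ}

/-- Formal cells over `D`: a cell has a level, a degree, a boundary, which is a formal linear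
combination of cells, and a value in `D`. -/
inductive Cell (D : GrDiffMod.{u, v} R d) : Type (max u v)
  | mk (level : ℕ) (deg : ZMod d) (n : ℕ) (c : Fin n → R) (x : Fin n → Cell D) (b : D.carrier)

namespace Cell

variable {D : GrDiffMod.{u, v} R d}

/-- The level of a cell. -/
def level : Cell D → ℕ
  | mk l _ _ _ _ _ => l

/-- The degree of a cell. -/
def deg : Cell D → ZMod d
  | mk _ k _ _ _ _ => k

/-- The value of a cell in `D`. -/
def val : Cell D → D.carrier
  | mk _ _ _ _ _ b => b

/-- The boundary of a cell. -/
noncomputable def bd : Cell D → (Cell D →₀ R)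
  | mk _ _ _ c x _ => ∑ i, Finsupp.single (x i) (c i)

/-- A cell is admissible if its boundary consists of admissible cells of lower level and suitable
degree, and boundary and value form a cycle of the mapping cone. -/
def Admissible : Cell D → Prop
  | mk l k _ c x b => (∀ i, (x i).Admissible ∧ (x i).level < l ∧ (x i).deg = k - 1) ∧
      ∑ i, c i • (x i).bd = 0 ∧ ∑ i, c i • (x i).val = D.diff b ∧ b ∈ D.grade k

end Cell

/-- Admissible cells over `D`. -/
abbrev AdmissibleCell (D : GrDiffMod.{u, v} R d) : Type (max u v) :=
  {p : Cell D // p.Admissible}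

namespace AdmissibleCell

variable {D : GrDiffMod.{u, v} R d}

/-- The boundary of an admissible cell. -/
noncomputable def bd : AdmissibleCell D → (AdmissibleCell D →₀ R)
  | ⟨.mk _ _ _ c x _, h⟩ => ∑ i, Finsupp.single ⟨x i, (h.1 i).1⟩ (c i)

theorem bd_mk {l n : ℕ} {k : ZMod d} {c : Fin n → R} {x : Fin n → Cell D} {b : D.carrier}
    (h : (Cell.mk l k n c x b).Admissible) :
    bd ⟨.mk l k n c x b, h⟩ = ∑ i, Finsupp.single ⟨x i, (h.1 i).1⟩ (c i) :=
  rfl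

/-- Admissibility states its identities in the free module on all cells; this compatibility, with
injectivity of `Finsupp.mapDomain` on the subtype inclusion, transfers them to admissible cells. -/
theorem mapDomain_bd (p : AdmissibleCell D) :
    Finsupp.lmapDomain R R Subtype.val p.bd = p.1.bd := by
  obtain ⟨⟨l, k, n, c, x, b⟩, h⟩ := p
  simp only [bd_mk, Cell.bd, map_sum, Finsupp.lmapDomain_apply, Finsupp.mapDomain_single]

theorem bd_mem (p : AdmissibleCell D) {l : ℕ} {k : ZMod d} (hl : p.1.level < l + 1)
    (hk : p.1.deg = k) :
    p.bd ∈ Finsupp.supported R R {q : AdmissibleCell D | q.1.level < l ∧ q.1.deg = k - 1} := by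
  obtain ⟨⟨l', k, n, c, x, b⟩, h⟩ := p
  subst hk
  exact Submodule.sum_mem _ fun i _ => Finsupp.single_mem_supported _ _
    ⟨(h.1 i).2.1.trans_le (Nat.lt_succ_iff.1 hl), (h.1 i).2.2⟩

theorem linearCombination_bd (p : AdmissibleCell D) :
    Finsupp.linearCombination R (bd (D := D)) p.bd = 0 := by
  apply Finsupp.mapDomain_injective Subtype.val_injective
  rw [← Finsupp.lmapDomain_apply R R, ← Finsupp.lmapDomain_apply R R, map_zero]
  obtain ⟨⟨l, k, n, c, x, b⟩, h⟩ := p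
  simpa only [bd_mk, map_sum, Finsupp.linearCombination_single, map_smul, mapDomain_bd] using h.2.1

theorem linearCombination_val (p : AdmissibleCell D) :
    Finsupp.linearCombination R (fun q : AdmissibleCell D => q.1.val) p.bd = D.diff p.1.val := by
  obtain ⟨⟨l, k, n, c, x, b⟩, h⟩ := p
  simpa only [bd_mk, map_sum, Finsupp.linearCombination_single, Cell.val] using h.2.2.1

theorem val_mem (p : AdmissibleCell D) : p.1.val ∈ D.grade p.1.deg := by
  obtain ⟨⟨l, k, n, c, x, b⟩, h⟩ := p
  exact h.2.2.2

/-- Every cycle of the mapping cone is the boundary, together with the value, of an admissible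
cell. -/
theorem exists_bd_eq {n : ℕ} {k : ZMod d} {a : AdmissibleCell D →₀ R} {b : D.carrier}
    (ha : a ∈ Finsupp.supported R R {q : AdmissibleCell D | q.1.level < n ∧ q.1.deg = k - 1})
    (hb : b ∈ D.grade k) (hda : Finsupp.linearCombination R (bd (D := D)) a = 0)
    (hab : Finsupp.linearCombination R (fun q : AdmissibleCell D => q.1.val) a = D.diff b) :
    ∃ p : AdmissibleCell D, p.1.level = n ∧ p.1.deg = k ∧ p.1.val = b ∧ p.bd = a := by
  obtain ⟨m, c, x, hx, h⟩ := a.exists_eq_sum_single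
  refine ⟨⟨.mk n k m c (fun i => (x i).1) b, fun i => ⟨(x i).2, ha (hx i)⟩, ?_, ?_, hb⟩,
    rfl, rfl, rfl, h.symm⟩
  · rw [h] at hda
    simpa only [map_sum, Finsupp.linearCombination_single, map_smul, mapDomain_bd, map_zero]
      using congrArg (Finsupp.lmapDomain R R Subtype.val) hda
  · rw [h] at hab
    simpa only [map_sum, Finsupp.linearCombination_single] using hab

end AdmissibleCell

/-- The free flag on the admissible cells over `D`. -/
noncomputable def cellFlag (D : GrDiffMod.{u, max u v} R d) : GrFlag.{u, max u v} R d where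
  carrier := AdmissibleCell D →₀ R
  grade k := Finsupp.supported R R {p | p.1.deg = k}
  isInternal := Finsupp.isInternal_supported_fiber _
  diff := Finsupp.linearCombination R AdmissibleCell.bd
  diff_diff := LinearMap.congr_fun (f := Finsupp.linearCombination R AdmissibleCell.bd ∘ₗ
    Finsupp.linearCombination R AdmissibleCell.bd) (g := 0)
      (Finsupp.lhom_ext' fun p => LinearMap.ext_ring (by simp [AdmissibleCell.linearCombination_bd]))
  diff_mem j _ hx := Finsupp.linearCombination_mem_of_mem_supported
    (S := {p : AdmissibleCell D | p.1.deg = j})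
    (fun p hp => Finsupp.supported_mono (fun _ hq => hq.2) (p.bd_mem (Nat.lt_succ_self _) hp)) hx
  -- The bound `< n + 1` makes `filPred n k` the span of the cells of level `< n` for every `n`,
  -- including the empty span at `n = 0`.
  fil n k := Finsupp.supported R R {p | p.1.level < n + 1 ∧ p.1.deg = k}
  fil_le_grade _ _ := Finsupp.supported_mono fun _ hp => hp.2
  fil_le_succ _ _ := Finsupp.supported_mono fun _ hp => ⟨hp.1.trans (Nat.lt_succ_self _), hp.2⟩
  exhaustive j x hx := ⟨x.support.sup fun p => p.1.level, fun _ hp =>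
    ⟨Nat.lt_succ_of_le (Finset.le_sup (f := fun p : AdmissibleCell D => p.1.level) hp), hx hp⟩⟩
  diff_fil_zero j x hx := by
    refine (Submodule.mem_bot R).1 (Finsupp.linearCombination_mem_of_mem_supported
      (S := {p : AdmissibleCell D | p.1.level < 0 + 1 ∧ p.1.deg = j}) (fun p hp => ?_) hx)
    rw [← Finsupp.supported_empty (M := R) (R := R)]
    exact Finsupp.supported_mono (fun q hq => absurd hq.1 (Nat.not_lt_zero _))
      (p.bd_mem hp.1 hp.2)
  diff_fil_succ i j _ hx := Finsupp.linearCombination_mem_of_mem_supported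
    (S := {p : AdmissibleCell D | p.1.level < i + 1 + 1 ∧ p.1.deg = j})
    (fun p hp => p.bd_mem hp.1 hp.2) hx

theorem cellFlag_filPred (D : GrDiffMod.{u, max u v} R d) (n : ℕ) (k : ZMod d) :
    (cellFlag.{u, v} D).filPred n k =
      Finsupp.supported R R {p : AdmissibleCell D | p.1.level < n ∧ p.1.deg = k} := by
  cases n with
  | zero =>
    simp only [Nat.not_lt_zero, false_and, Set.ofPred_false, Finsupp.supported_empty]
    rfl
  | succ n => rfl

/-- Each graded piece is free on the cells of level exactly `n` and degree `k`. -/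
theorem cellFlag_isProjective (D : GrDiffMod.{u, max u v} R d) :
    (cellFlag.{u, v} D).IsProjective := by
  have (n : ℕ) (k : ZMod d) : Module.Projective R (Finsupp.supported R R
      ({p : AdmissibleCell D | p.1.level < n + 1 ∧ p.1.deg = k} \
        {p : AdmissibleCell D | p.1.level < n ∧ p.1.deg = k})) :=
    Module.Projective.of_equiv (Finsupp.supportedEquivFinsupp _).symm
  refine .of_exists_surjective (fun n k => Finsupp.supported R R
    ({p : AdmissibleCell D | p.1.level < n + 1 ∧ p.1.deg = k} \
      {p : AdmissibleCell D | p.1.level < n ∧ p.1.deg = k})) fun n k => ?_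
  rw [cellFlag_filPred]
  exact Finsupp.exists_surjective_supported_diff

/-- The augmentation of the free flag on the admissible cells over `D`. -/
noncomputable def cellFlagAug (D : GrDiffMod.{u, max u v} R d) :
    Hom (cellFlag.{u, v} D).toGrDiffMod D where
  toLin := Finsupp.linearCombination R fun q : AdmissibleCell D => q.1.val
  map_mem _ _ hx := Finsupp.linearCombination_mem_of_mem_supported
    (fun p hp => by rw [← show p.1.deg = _ from hp]; exact p.val_mem) hx
  comm := LinearMap.congr_fun
    (f := D.diff ∘ₗ Finsupp.linearCombination R fun q : AdmissibleCell D => q.1.val)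
    (g := (Finsupp.linearCombination R fun q : AdmissibleCell D => q.1.val) ∘ₗ
      Finsupp.linearCombination R AdmissibleCell.bd)
    (Finsupp.lhom_ext' fun p => LinearMap.ext_ring
      (by simp [AdmissibleCell.linearCombination_val]))

/-- A cone cycle is the boundary and value of a single cell `p`, so `(p, 0)` bounds it. -/
theorem filteredAcyclic_cellFlagAug (D : GrDiffMod.{u, max u v} R d) :
    (cellFlag.{u, v} D).FilteredAcyclic (cellFlagAug.{u, v} D) := by
  intro n k a ha b hb hda hab
  rw [cellFlag_filPred] at ha
  obtain ⟨p, hn, hk, rfl, rfl⟩ := AdmissibleCell.exists_bd_eq ha hb hda hab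
  refine ⟨(Finsupp.single p (1 : R) : AdmissibleCell D →₀ R),
    Finsupp.single_mem_supported R _ ⟨Nat.lt_succ_of_le hn.le, hk⟩, 0, zero_mem _, ?_, ?_⟩
  · have h : Finsupp.linearCombination R AdmissibleCell.bd (Finsupp.single p (1 : R)) = p.bd := by
      simp
    exact h
  · have h : Finsupp.linearCombination R (fun q : AdmissibleCell D => q.1.val)
        (Finsupp.single p (1 : R)) = p.1.val := by
      simp
    rw [map_zero, sub_zero]
    exact h

end GrDiffMod

/-- Cells carry coefficients from `R` as well as elements of `D`, so the universe of `D` has to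
absorb that of `R`. -/
theorem AnchoredResolution.exists_resolution {R : Type u} [CommRing R] {d : ℕ}
    (D : GrDiffMod.{u, max u v} R d) : Nonempty (AnchoredResolution D) :=
  ⟨.ofFilteredAcyclic (GrDiffMod.cellFlag.{u, v} D) (GrDiffMod.cellFlag_isProjective.{u, v} D)
    (GrDiffMod.cellFlagAug.{u, v} D) (GrDiffMod.filteredAcyclic_cellFlagAug.{u, v} D)⟩

theorem theorem3p2 {R : Type u} [CommRing R] (d : ℕ) :
    -- every differential module has an anchored resolution
    (∀ D : GrDiffMod.{u, max u v} R d, Nonempty (AnchoredResolution D)) ∧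
    -- lifting of morphisms to any given anchored resolutions
    (∀ (D D' : GrDiffMod.{u, max u v} R d) (φ : GrDiffMod.Hom D D')
      (F : AnchoredResolution D) (F' : AnchoredResolution D'),
      ∃ ψ : GrDiffMod.Hom F.flag.toGrDiffMod F'.flag.toGrDiffMod,
        GrFlag.FlagPreserving ψ ∧
        GrDiffMod.Homotopic (F'.aug.comp ψ) (φ.comp F.aug)) ∧
    -- uniqueness up to flag-preserving homotopy equivalence
    (∀ (D : GrDiffMod.{u, max u v} R d) (F F' : AnchoredResolution D),
      GrFlag.FlagHomotopyEquivalent F.flag F'.flag) :=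
  ⟨AnchoredResolution.exists_resolution.{u, v},
    fun _ _ φ F F' => AnchoredResolution.exists_lift φ F F',
    fun _ F F' => F.flagHomotopyEquivalent F'⟩
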